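/- Let $c,k,m\ge 1$ be integers. Workers are grouped into $c$ clusters; cluster $u\in[c]$ has $n_u\ge 1$ workers, each of which has to compute $\tau_u\ge 1$ tasks, and $n=\sum_u n_u$ (the product of two matrices computed by RPM3 is divided into $km$ smaller products). Under the cluster-dependent additive service time model all task times are independent, and each task of a worker of cluster $u$ takes a shifted exponential time with shift $s_u/(km)$ and rate $\lambda_u km$, i.e. with density $\lambda_u km\,e^{-\lambda_u km(x-s_u/(km))}$ for $x>s_u/(km)$ and $0$ otherwise, where $\lambda_u>0$ and $\lambda_u s_u=t_m$ does not depend on $u$. Cluster $c$ is the slowest: $\lambda_c=\min_u\lambda_u$. Let $T_u^i$ be the time spent by the $i$-th worker of cluster $u$ on its $\tau_u$ tasks (the sum of its task times), and let $T_{RPM3}=\max_{u\in[c]}\max_{i\in[n_u]}T_u^i$ be the waiting time of the master. Put $\tau_{\max}=\max_u\tau_u$ and $s_m=\max_u s_u\tau_u$. 1. Each $T_u^i$ is a shifted Erlang variable with shape $\tau_u$, rate $\lambda_u km$ and shift $\tau_u s_u/(km)$. 2. For every $x\ge s_m/(km)$, $$\Pr(T_{RPM3}>x)\le 1-\Big(1-\sum_{j=0}^{\tau_{\max}-1}\frac{e^{\lambda_c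 s_m-\lambda_c kmx}}{j!}\,(\lambda_c kmx-\lambda_c s_m)^j\Big)^n ,$$ and the inequality is strict if $x>s_m/(km)$ and the clusters do not all have $\lambda_u=\lambda_c$ and $\tau_u=\tau_{\max}$. For $x<s_m/(km)$, $\Pr(T_{RPM3}\le x)=0$. For $x\ge s_m/(km)$ the expression inside the $n$-th power is the distribution function at $x$ of the Erlang law with shape $\tau_{\max}$ and rate $\lambda_c km$ shifted by $s_m/(km)$. 3. $T_{RPM3}$ is integrable and $\mathbb{E}[T_{RPM3}]\le \frac{s_m}{km}+\Phi(n)$, where $$\Phi(n)=\frac{n}{\lambda_c km\,(\tau_{\max}-1)!}\sum_{j=0}^{n-1}(-1)^j\binom{n-1}{j}\sum_{\ell=0}^{(\tau_{\max}-1)j}a_\ell(\tau_{\max},j)\,\frac{(\tau_{\max}+\ell)!}{(j+1)^{\tau_{\max}+\ell+1}}$$ and $a_\ell(\tau_{\max},j)$ is the coefficient of $x^\ell$ in $\Big(\sum_{i=0}^{\tau_{\max}-1}\frac{x^i}{i!}\Big)^j$. Moreover, $\Phi(n)$ is the mean of the maximum of $n$ independent Erlang variables with shape $\tau_{\max}$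 and rate $\lambda_c km$; this maximum is integrable. -/

import Mathlib

open MeasureTheory ProbabilityTheory

noncomputable section

/-- Law of `a + E`, where `E` is exponential with rate `r`: density `r * exp (-r * (x - a))`
for `x > a` and `0` otherwise. -/
def shiftedExp (a r : ℝ) : Measure ℝ :=
  (expMeasure r).map (fun x => x + a)

/-- Erlang law with (positive integer) shape `t` and rate `r`. -/
def erlang (t : ℕ) (r : ℝ) : Measure ℝ :=
  gammaMeasure (t : ℝ) r

/-- Law of `a + E`, where `E` is Erlang with shape `t` and rate `r`. -/
def shiftedErlang (t : ℕ) (a r : ℝ) : Measure ℝ :=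
  (erlang t r).map (fun x => x + a)

/-- Cluster-dependent additive service time. There are `c` clusters, cluster `u` has `n u` workers,
each of which computes `τ u` tasks; `X u i j` is the time spent by worker `i` of cluster `u` on its
`j`-th task. All task times are independent, and those of cluster `u` are shifted exponential with
shift `s u / (k * m)` and rate `lam u * (k * m)`. -/
structure IsAdditiveServiceTime {Ω : Type*} [MeasurableSpace Ω] (P : Measure Ω) (k m : ℕ) {c : ℕ}
    (n τ : Fin c → ℕ) (lam s : Fin c → ℝ)
    (X : (u : Fin c) → Fin (n u) → Fin (τ u) → Ω → ℝ) : Prop where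
  measurable : ∀ u i j, Measurable (X u i j)
  law : ∀ u i j, P.map (X u i j) = shiftedExp (s u / (k * m)) (lam u * (k * m))
  indep : iIndepFun
    (fun a : (u : Fin c) × (Fin (n u) × Fin (τ u)) => X a.1 a.2.1 a.2.2) P

/-- Time spent by worker `i` of cluster `u` to compute its `τ u` tasks. -/
def workerTime {Ω : Type*} {c : ℕ} {n τ : Fin c → ℕ}
    (X : (u : Fin c) → Fin (n u) → Fin (τ u) → Ω → ℝ) (u : Fin c) (i : Fin (n u)) (ω : Ω) : ℝ :=
  ∑ j, X u i j ω

/-- Time until all the workers of cluster `u` have computed their `τ u` tasks. -/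
def clusterTime {Ω : Type*} {c : ℕ} {n τ : Fin c → ℕ}
    (X : (u : Fin c) → Fin (n u) → Fin (τ u) → Ω → ℝ) (u : Fin c) (ω : Ω) : ℝ :=
  ⨆ i, workerTime X u i ω

/-- Waiting time of the master. -/
def waitingTime {Ω : Type*} {c : ℕ} {n τ : Fin c → ℕ}
    (X : (u : Fin c) → Fin (n u) → Fin (τ u) → Ω → ℝ) (ω : Ω) : ℝ :=
  ⨆ u, clusterTime X u ω

/-- Coefficient of `x ^ l` in `(∑_{i < t} x ^ i / i!) ^ j`. -/
def expandCoeff (t j l : ℕ) : ℝ :=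
  ((∑ i ∈ Finset.range t, Polynomial.monomial i (1 / (i.factorial : ℝ))) ^ j).coeff l

/-- The alternating double sum `Φ(N)` for shape `t` and rate `r`. -/
def erlangMaxMean (N t : ℕ) (r : ℝ) : ℝ :=
  (N : ℝ) / (r * ((t - 1).factorial : ℝ)) *
    ∑ j ∈ Finset.range N, (-1 : ℝ) ^ j * ((N - 1).choose j : ℝ) *
      ∑ l ∈ Finset.range ((t - 1) * j + 1),
        expandCoeff t j l * ((t + l).factorial : ℝ) / ((j : ℝ) + 1) ^ (t + l + 1)

end

/-! Everything rests on `erlangBase t y`, the unit-rate Erlang distribution function. For `t ≥ 1` it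
increases in `y ≥ 0`, and each extra unit of shape subtracts a Poisson weight. Hence lowering the
rate, or raising the shape or the shift, can only lower a shifted Erlang distribution function
(`erlangBase_le_erlangBase`).

A worker's time is a sum of independent exponentials plus a constant, hence shifted Erlang
(`erlang_conv_expMeasure`), and workers are independent because they own disjoint sets of tasks
(`iIndepFun_curry`). The distribution function of the waiting time is therefore a product of `N`
factors, each at least the one with the worst shape, rate and shift; this is the tail bound.

The bound is the tail of a constant plus the maximum of `N` independent Erlang variables, so
integrating tails bounds the mean (`integrable_and_integral_le_of_tail_le`). The mean of that
maximum comes from expanding its density binomially into terms `x ^ p * exp (-b x)`. -/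

/-! ### The unit-rate Erlang distribution function -/

/-- Distribution function at `y ≥ 0` of the Erlang law with shape `t` and rate `1`. -/
noncomputable def erlangBase (t : ℕ) (y : ℝ) : ℝ :=
  1 - ∑ j ∈ Finset.range t, Real.exp (-y) / (j.factorial : ℝ) * y ^ j

lemma erlangBase_succ (d : ℕ) (y : ℝ) :
    erlangBase (d + 1) y = erlangBase d y - Real.exp (-y) / (d.factorial : ℝ) * y ^ d := by
  rw [erlangBase, erlangBase, Finset.sum_range_succ]; ring

/-- The derivative telescopes: differentiating the newest Poisson term cancels the derivative
already obtained and leaves the next one. -/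
lemma hasDerivAt_erlangBase (d : ℕ) (y : ℝ) :
    HasDerivAt (erlangBase (d + 1)) (Real.exp (-y) / (d.factorial : ℝ) * y ^ d) y := by
  have hexp : HasDerivAt (fun y : ℝ => Real.exp (-y)) (-Real.exp (-y)) y := by
    simpa using (hasDerivAt_neg y).exp
  induction d with
  | zero =>
    have : erlangBase (0 + 1) = fun y => 1 - Real.exp (-y) := by
      funext y; simp [erlangBase]
    rw [this]
    simpa using hexp.const_sub 1
  | succ d ih =>
    have : erlangBase (d + 1 + 1) = fun y => erlangBase (d + 1) y -
        Real.exp (-y) / ((d + 1).factorial : ℝ) * y ^ (d + 1) := by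
      funext y; exact erlangBase_succ _ _
    rw [this]
    refine (ih.sub ((hexp.div_const _).mul (hasDerivAt_pow (d + 1) y))).congr_deriv ?_
    rw [Nat.factorial_succ]
    push_cast
    have h1 : (d.factorial : ℝ) ≠ 0 := by positivity
    have h2 : (d : ℝ) + 1 ≠ 0 := by positivity
    field_simp
    ring

lemma continuous_erlangBase (t : ℕ) : Continuous (erlangBase t) := by
  unfold erlangBase; fun_prop

lemma erlangBase_zero {t : ℕ} (ht : 0 < t) : erlangBase t 0 = 0 := by
  obtain ⟨d, rfl⟩ := Nat.exists_eq_add_of_lt ht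
  simp [erlangBase, Finset.sum_range_succ']

lemma strictMonoOn_erlangBase {t : ℕ} (ht : 0 < t) :
    StrictMonoOn (erlangBase t) (Set.Ici 0) := by
  obtain ⟨d, rfl⟩ := Nat.exists_eq_succ_of_ne_zero ht.ne'
  refine strictMonoOn_of_deriv_pos (convex_Ici 0) (continuous_erlangBase _).continuousOn ?_
  intro y hy
  rw [interior_Ici, Set.mem_Ioi] at hy
  rw [(hasDerivAt_erlangBase d y).deriv]
  positivity

lemma erlangBase_nonneg {t : ℕ} (ht : 0 < t) {y : ℝ} (hy : 0 ≤ y) : 0 ≤ erlangBase t y := by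
  rw [← erlangBase_zero ht]
  exact (strictMonoOn_erlangBase ht).monotoneOn (Set.mem_Ici.2 le_rfl) hy hy

lemma erlangBase_pos {t : ℕ} (ht : 0 < t) {y : ℝ} (hy : 0 < y) : 0 < erlangBase t y := by
  rw [← erlangBase_zero ht]
  exact strictMonoOn_erlangBase ht (Set.mem_Ici.2 le_rfl) hy.le hy

lemma antitone_erlangBase {y : ℝ} (hy : 0 ≤ y) : Antitone fun t => erlangBase t y :=
  antitone_nat_of_succ_le fun d => by
    rw [erlangBase_succ]
    have : 0 ≤ Real.exp (-y) / (d.factorial : ℝ) * y ^ d := by positivity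
    linarith

lemma strictAnti_erlangBase {y : ℝ} (hy : 0 < y) : StrictAnti fun t => erlangBase t y :=
  strictAnti_nat_of_succ_lt fun d => by
    rw [erlangBase_succ]
    have : 0 < Real.exp (-y) / (d.factorial : ℝ) * y ^ d := by positivity
    linarith

/-! ### Erlang measures and their convolution -/

/-- Integral over a half-line of a density supported on the nonnegative reals. -/
lemma setLIntegral_Iic_ofReal_of_hasDerivAt {g H h : ℝ → ℝ}
    (hneg : ∀ y < 0, g y = 0) (hg : ∀ y, 0 ≤ y → g y = h y)
    (hnn : ∀ y, 0 ≤ y → 0 ≤ h y) (hc : Continuous h)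
    (hH : ∀ y, HasDerivAt H (h y) y) {x : ℝ} (hx : 0 ≤ x) :
    ∫⁻ y in Set.Iic x, ENNReal.ofReal (g y) = ENNReal.ofReal (H x - H 0) := by
  rw [lintegral_Iic_eq_lintegral_Iio_add_Icc _ hx,
    setLIntegral_congr_fun (g := fun _ => 0) measurableSet_Iio
      (fun y hy => by simp [hneg y hy]), lintegral_zero, zero_add,
    setLIntegral_congr_fun (g := fun y => ENNReal.ofReal (h y)) measurableSet_Icc
      (fun y hy => by simp [hg y hy.1]),
    ← ofReal_integral_eq_lintegral_ofReal hc.integrableOn_Icc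
      ((ae_restrict_iff' measurableSet_Icc).2 (ae_of_all _ fun y hy => hnn y hy.1)),
    integral_Icc_eq_integral_Ioc, ← intervalIntegral.integral_of_le hx,
    intervalIntegral.integral_eq_sub_of_hasDerivAt (fun y _ => hH y) (hc.intervalIntegrable _ _)]

lemma setLIntegral_Iic_ofReal_of_neg {g : ℝ → ℝ} (hneg : ∀ y < 0, g y = 0) {x : ℝ} (hx : x < 0) :
    ∫⁻ y in Set.Iic x, ENNReal.ofReal (g y) = 0 := by
  rw [setLIntegral_congr_fun (g := fun _ => 0) measurableSet_Iic
      (fun y hy => by simp [hneg y (lt_of_le_of_lt hy hx)]), lintegral_zero]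

lemma gammaPDFReal_natCast_succ (d : ℕ) {r x : ℝ} (hx : 0 ≤ x) :
    gammaPDFReal ((d + 1 : ℕ) : ℝ) r x =
      r ^ (d + 1) / (d.factorial : ℝ) * x ^ d * Real.exp (-(r * x)) := by
  rw [gammaPDFReal, if_pos hx, Real.rpow_natCast, Nat.cast_succ, Real.Gamma_nat_eq_factorial,
    add_sub_cancel_right, Real.rpow_natCast]

lemma gammaPDFReal_of_neg (a r : ℝ) {x : ℝ} (hx : x < 0) : gammaPDFReal a r x = 0 := by
  rw [gammaPDFReal, if_neg (not_le.2 hx)]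

lemma isProbabilityMeasure_erlang {t : ℕ} (ht : 0 < t) {r : ℝ} (hr : 0 < r) :
    IsProbabilityMeasure (erlang t r) :=
  isProbabilityMeasure_gammaMeasure (Nat.cast_pos.2 ht) hr

lemma erlang_Iic {t : ℕ} (ht : 0 < t) {r : ℝ} (hr : 0 < r) {x : ℝ} (hx : 0 ≤ x) :
    erlang t r (Set.Iic x) = ENNReal.ofReal (erlangBase t (r * x)) := by
  obtain ⟨d, rfl⟩ := Nat.exists_eq_succ_of_ne_zero ht.ne'
  rw [erlang, gammaMeasure, withDensity_apply _ measurableSet_Iic]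
  have h := setLIntegral_Iic_ofReal_of_hasDerivAt (g := gammaPDFReal ((d + 1 : ℕ) : ℝ) r)
    (H := fun y => erlangBase (d + 1) (r * y))
    (h := fun y => r ^ (d + 1) / (d.factorial : ℝ) * y ^ d * Real.exp (-(r * y)))
    (fun y hy => gammaPDFReal_of_neg _ _ hy) (fun y hy => gammaPDFReal_natCast_succ d hy)
    (fun y hy => by positivity) (by fun_prop)
    (fun y => by
      refine ((hasDerivAt_erlangBase d (r * y)).comp y
        ((hasDerivAt_id y).const_mul r)).congr_deriv ?_
      rw [mul_pow, pow_succ]; ring) hx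
  simpa [gammaPDF, erlangBase_zero ht] using h

lemma erlang_Iic_of_neg (t : ℕ) (r : ℝ) {x : ℝ} (hx : x < 0) :
    erlang t r (Set.Iic x) = 0 := by
  rw [erlang, gammaMeasure, withDensity_apply _ measurableSet_Iic]
  exact setLIntegral_Iic_ofReal_of_neg (fun y hy => gammaPDFReal_of_neg _ _ hy) hx

lemma isProbabilityMeasure_shiftedErlang {t : ℕ} (ht : 0 < t) (a : ℝ) {r : ℝ} (hr : 0 < r) :
    IsProbabilityMeasure (shiftedErlang t a r) := by
  have := isProbabilityMeasure_erlang ht hr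
  exact Measure.isProbabilityMeasure_map (by fun_prop)

lemma shiftedErlang_Iic (t : ℕ) (a r x : ℝ) :
    shiftedErlang t a r (Set.Iic x) = erlang t r (Set.Iic (x - a)) := by
  rw [shiftedErlang, Measure.map_apply (by fun_prop) measurableSet_Iic]
  congr 1
  ext y
  simp [le_sub_iff_add_le]

/-- In the convolution integral the exponentials multiply to `exp (-(r * x))`, which is free of `y`;
what remains is the integral of `y ^ d` over `[0, x]`. -/
lemma erlang_conv_expMeasure {t : ℕ} (ht : 0 < t) {r : ℝ} (hr : 0 < r) :
    (erlang t r).conv (expMeasure r) = erlang (t + 1) r := by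
  obtain ⟨d, rfl⟩ := Nat.exists_eq_succ_of_ne_zero ht.ne'
  rw [erlang, expMeasure, erlang, gammaMeasure, gammaMeasure, gammaMeasure,
    conv_withDensity_eq_lconvolution (by unfold gammaPDF; fun_prop)
      (by unfold gammaPDF; fun_prop)]
  congr 1
  funext x
  rw [lconvolution_def]
  -- The exponential density vanishes at `x - y` when `y > x`, so the convolution is an integral
  -- over a half-line.
  have hsupp : ∀ y, gammaPDF ((d + 1 : ℕ) : ℝ) r y * gammaPDF 1 r (-y + x) =
      (Set.Iic x).indicator (fun y => ENNReal.ofReal (gammaPDFReal ((d + 1 : ℕ) : ℝ) r y *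
        gammaPDFReal 1 r (-y + x))) y := by
    intro y
    by_cases hy : y ≤ x
    · rw [Set.indicator_of_mem (Set.mem_Iic.2 hy), gammaPDF, gammaPDF,
        ENNReal.ofReal_mul (gammaPDFReal_nonneg (by positivity) hr y)]
    · rw [Set.indicator_of_notMem (by simpa using hy), gammaPDF_of_neg (x := -y + x)
        (by linarith [not_le.1 hy]), mul_zero]
  simp_rw [hsupp]
  rw [lintegral_indicator measurableSet_Iic, gammaPDF]
  rcases lt_or_ge x 0 with hx | hx
  · rw [setLIntegral_Iic_ofReal_of_neg (fun y hy => by rw [gammaPDFReal_of_neg _ _ hy, zero_mul])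
      hx, gammaPDFReal_of_neg _ _ hx, ENNReal.ofReal_zero]
  · have hcongr : ∫⁻ y in Set.Iic x, ENNReal.ofReal (gammaPDFReal ((d + 1 : ℕ) : ℝ) r y *
        gammaPDFReal 1 r (-y + x)) = ∫⁻ y in Set.Iic x, ENNReal.ofReal (if 0 ≤ y then
          r ^ (d + 2) / (d.factorial : ℝ) * y ^ d * Real.exp (-(r * x)) else 0) := by
      refine setLIntegral_congr_fun measurableSet_Iic fun y hy => ?_
      have hyx : 0 ≤ -y + x := by linarith [Set.mem_Iic.1 hy]
      split_ifs with h0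
      · have h1 := gammaPDFReal_natCast_succ 0 (r := r) hyx
        rw [zero_add, Nat.cast_one] at h1
        rw [gammaPDFReal_natCast_succ d h0, h1]
        have hexp : Real.exp (-(r * x)) = Real.exp (-(r * y)) * Real.exp (-(r * (-y + x))) := by
          rw [← Real.exp_add]; congr 1; ring
        rw [hexp]
        congr 1
        simp
        ring
      · rw [gammaPDFReal_of_neg _ _ (not_le.1 h0), zero_mul]
    rw [hcongr, setLIntegral_Iic_ofReal_of_hasDerivAt
      (h := fun y => r ^ (d + 2) / (d.factorial : ℝ) * y ^ d * Real.exp (-(r * x)))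
      (H := fun y => r ^ (d + 2) / ((d + 1).factorial : ℝ) * y ^ (d + 1) * Real.exp (-(r * x)))
      (fun y hy => if_neg (not_le.2 hy)) (fun y hy => if_pos hy) (fun y hy => by positivity)
      (by fun_prop) ?_ hx, gammaPDFReal_natCast_succ (d + 1) hx]
    · simp
    · intro y
      refine (((hasDerivAt_pow (d + 1) y).const_mul _).mul_const _).congr_deriv ?_
      rw [Nat.factorial_succ]
      push_cast
      have h1 : (d.factorial : ℝ) ≠ 0 := by positivity
      have h2 : (d : ℝ) + 1 ≠ 0 := by positivity
      field_simp

/-! ### Mean of the maximum of independent Erlang variables -/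

lemma integral_pow_mul_exp_neg_mul_Ioi (p : ℕ) {b : ℝ} (hb : 0 < b) :
    ∫ x in Set.Ioi (0 : ℝ), x ^ p * Real.exp (-(b * x)) = (p.factorial : ℝ) / b ^ (p + 1) := by
  have h := Real.integral_rpow_mul_exp_neg_mul_Ioi (a := (p : ℝ) + 1) (by positivity) hb
  rw [add_sub_cancel_right, Real.Gamma_nat_eq_factorial] at h
  simp only [Real.rpow_natCast] at h
  rw [h, ← Nat.cast_succ, Real.rpow_natCast, one_div, inv_pow]
  field_simp

lemma integrableOn_pow_mul_exp_neg_mul_Ioi (p : ℕ) {b : ℝ} (hb : 0 < b) :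
    IntegrableOn (fun x : ℝ => x ^ p * Real.exp (-(b * x))) (Set.Ioi 0) := by
  have h := integrableOn_rpow_mul_exp_neg_mul_rpow (p := 1) (s := p) (b := b)
    (lt_of_lt_of_le (by norm_num) (Nat.cast_nonneg p)) one_pos hb
  simpa using h

/-- Density of the maximum of `N` independent Erlang variables with shape `t` and rate `r`. -/
noncomputable def erlangMaxPDFReal (N t : ℕ) (r x : ℝ) : ℝ :=
  if 0 ≤ x then N * erlangBase t (r * x) ^ (N - 1) *
    (r ^ t / ((t - 1).factorial : ℝ) * x ^ (t - 1) * Real.exp (-(r * x))) else 0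

lemma measurable_erlangMaxPDFReal (N t : ℕ) (r : ℝ) : Measurable (erlangMaxPDFReal N t r) := by
  refine Measurable.ite measurableSet_Ici (Continuous.measurable ?_) measurable_const
  have := continuous_erlangBase t
  fun_prop

lemma erlangMaxPDFReal_nonneg (N : ℕ) {t : ℕ} (ht : 0 < t) {r : ℝ} (hr : 0 < r) (x : ℝ) :
    0 ≤ erlangMaxPDFReal N t r x := by
  unfold erlangMaxPDFReal
  split_ifs with hx
  · have := erlangBase_nonneg ht (mul_nonneg hr.le hx)
    positivity
  · rfl

lemma setLIntegral_Iic_erlangMaxPDFReal {N t : ℕ} (hN : 0 < N) (ht : 0 < t) {r : ℝ} (hr : 0 < r)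
    {x : ℝ} (hx : 0 ≤ x) :
    ∫⁻ y in Set.Iic x, ENNReal.ofReal (erlangMaxPDFReal N t r y) =
      ENNReal.ofReal (erlangBase t (r * x) ^ N) := by
  obtain ⟨d, rfl⟩ := Nat.exists_eq_succ_of_ne_zero ht.ne'
  unfold erlangMaxPDFReal
  rw [setLIntegral_Iic_ofReal_of_hasDerivAt (H := fun y => erlangBase (d + 1) (r * y) ^ N)
    (fun y hy => if_neg (not_le.2 hy)) (fun y hy => if_pos hy) ?_ ?_ ?_ hx]
  · simp [erlangBase_zero ht, hN.ne']
  · intro y hy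
    have := erlangBase_nonneg ht (mul_nonneg hr.le hy)
    positivity
  · have := continuous_erlangBase d.succ
    fun_prop
  · intro y
    refine (((hasDerivAt_erlangBase d (r * y)).comp y
        ((hasDerivAt_id y).const_mul r)).pow N).congr_deriv ?_
    simp only [Nat.succ_eq_add_one, add_tsub_cancel_right, Function.comp_apply, mul_one,
      mul_pow, pow_succ]
    ring

lemma measurable_iSup_apply {ι : Type*} [Countable ι] :
    Measurable fun y : ι → ℝ => ⨆ i, y i :=
  Measurable.iSup fun i => measurable_pi_apply i

lemma pi_setOf_iSup_le {ι : Type*} [Fintype ι] [Nonempty ι] (ν : ι → Measure ℝ)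
    [∀ i, SigmaFinite (ν i)] (x : ℝ) :
    Measure.pi ν {y | ⨆ i, y i ≤ x} = ∏ i, ν i (Set.Iic x) := by
  have : {y : ι → ℝ | ⨆ i, y i ≤ x} = Set.univ.pi fun _ => Set.Iic x := by
    ext y
    simp [ciSup_le_iff (Set.finite_range y).bddAbove, Pi.le_def]
  rw [this, Measure.pi_pi]

/-- Both sides give `Iic x` the mass `F x ^ N`, where `F` is the Erlang distribution function: the
left by independence, the right because the density is the derivative of `F ^ N` on the nonnegative
reals. -/
lemma map_iSup_pi_erlang {N t : ℕ} (hN : 0 < N) (ht : 0 < t) {r : ℝ} (hr : 0 < r) :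
    (Measure.pi fun _ : Fin N => erlang t r).map (fun y => ⨆ i, y i) =
      volume.withDensity fun x => ENNReal.ofReal (erlangMaxPDFReal N t r x) := by
  have := isProbabilityMeasure_erlang ht hr
  have : Nonempty (Fin N) := ⟨⟨0, hN⟩⟩
  have : IsProbabilityMeasure ((Measure.pi fun _ : Fin N => erlang t r).map
      (fun y => ⨆ i, y i)) := Measure.isProbabilityMeasure_map measurable_iSup_apply.aemeasurable
  refine Measure.ext_of_Iic _ _ fun x => ?_
  rw [Measure.map_apply measurable_iSup_apply measurableSet_Iic,
    withDensity_apply _ measurableSet_Iic]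
  change Measure.pi _ {y | ⨆ i, y i ≤ x} = _
  rw [pi_setOf_iSup_le]
  rcases lt_or_ge x 0 with hx | hx
  · unfold erlangMaxPDFReal
    rw [setLIntegral_Iic_ofReal_of_neg (fun y hy => if_neg (not_le.2 hy)) hx]
    simp [erlang_Iic_of_neg t r hx, hN.ne']
  · rw [setLIntegral_Iic_erlangMaxPDFReal hN ht hr hx]
    simp [erlang_Iic ht hr hx, ENNReal.ofReal_pow (erlangBase_nonneg ht (mul_nonneg hr.le hx))]

lemma pow_truncated_exp_eq_sum (t j : ℕ) (x : ℝ) :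
    (∑ i ∈ Finset.range t, x ^ i / (i.factorial : ℝ)) ^ j =
      ∑ l ∈ Finset.range ((t - 1) * j + 1), expandCoeff t j l * x ^ l := by
  set p : Polynomial ℝ := ∑ i ∈ Finset.range t, Polynomial.monomial i (1 / (i.factorial : ℝ))
    with hp
  have hdeg : p.natDegree ≤ t - 1 :=
    Polynomial.natDegree_sum_le_of_forall_le _ _ fun i hi =>
      (Polynomial.natDegree_monomial_le _).trans (Nat.le_sub_one_of_lt (Finset.mem_range.1 hi))
  have hdeg' : (p ^ j).natDegree < (t - 1) * j + 1 := by
    refine Nat.lt_succ_of_le (Polynomial.natDegree_pow_le.trans ?_)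
    rw [mul_comm]
    gcongr
  have heval : p.eval x = ∑ i ∈ Finset.range t, x ^ i / (i.factorial : ℝ) := by
    rw [hp, Polynomial.eval_finsetSum]
    refine Finset.sum_congr rfl fun i _ => ?_
    rw [Polynomial.eval_monomial]; ring
  rw [← heval, ← Polynomial.eval_pow, Polynomial.eval_eq_sum_range' hdeg']
  rfl

lemma erlangBase_pow_eq_sum (t M : ℕ) (y : ℝ) :
    erlangBase t y ^ M = ∑ j ∈ Finset.range (M + 1), (-1 : ℝ) ^ j * (M.choose j : ℝ) *
      ∑ l ∈ Finset.range ((t - 1) * j + 1), expandCoeff t j l * y ^ l *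
        Real.exp (-(j * y)) := by
  have h : erlangBase t y =
      -(Real.exp (-y) * ∑ i ∈ Finset.range t, y ^ i / (i.factorial : ℝ)) + 1 := by
    rw [erlangBase, Finset.mul_sum, sub_eq_neg_add]
    congr 2
    exact Finset.sum_congr rfl fun i _ => by ring
  rw [h, add_pow]
  refine Finset.sum_congr rfl fun j _ => ?_
  rw [← Finset.sum_mul, ← pow_truncated_exp_eq_sum, neg_pow, mul_pow, ← Real.exp_nat_mul]
  simp only [one_pow, mul_neg]
  ring

/-- After expansion each term is a constant times `x ^ (t + l) * exp (-((j + 1) r x))`, a Gamma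
integral; of the powers of `r` only one factor `1 / r` survives. -/
lemma integrableOn_and_integral_mul_erlangMaxPDFReal {N t : ℕ} (hN : 0 < N) (ht : 0 < t) {r : ℝ} (hr : 0 < r) :
    IntegrableOn (fun x => x * erlangMaxPDFReal N t r x) (Set.Ioi 0) ∧
      ∫ x in Set.Ioi 0, x * erlangMaxPDFReal N t r x = erlangMaxMean N t r := by
  set C : ℝ := N * r ^ t / ((t - 1).factorial : ℝ) with hC
  have hexpand : Set.EqOn (fun x => x * erlangMaxPDFReal N t r x)
      (fun x => ∑ j ∈ Finset.range N, ∑ l ∈ Finset.range ((t - 1) * j + 1),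
        C * ((-1 : ℝ) ^ j * ((N - 1).choose j : ℝ)) * expandCoeff t j l * r ^ l *
          (x ^ (t + l) * Real.exp (-(((j : ℝ) + 1) * r * x)))) (Set.Ioi 0) := by
    intro x hx
    dsimp only
    rw [erlangMaxPDFReal, if_pos (le_of_lt hx), erlangBase_pow_eq_sum, Nat.sub_add_cancel hN]
    have : x * (N * (∑ j ∈ Finset.range N, (-1 : ℝ) ^ j * ((N - 1).choose j : ℝ) *
        ∑ l ∈ Finset.range ((t - 1) * j + 1), expandCoeff t j l * (r * x) ^ l *
          Real.exp (-(j * (r * x)))) *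
        (r ^ t / ((t - 1).factorial : ℝ) * x ^ (t - 1) * Real.exp (-(r * x)))) =
        (C * (x * x ^ (t - 1)) * Real.exp (-(r * x))) *
        (∑ j ∈ Finset.range N, (-1 : ℝ) ^ j * ((N - 1).choose j : ℝ) *
        ∑ l ∈ Finset.range ((t - 1) * j + 1), expandCoeff t j l * (r * x) ^ l *
          Real.exp (-(j * (r * x)))) := by
      rw [hC]; ring
    rw [this, ← pow_succ', Nat.sub_add_cancel ht, Finset.mul_sum]
    refine Finset.sum_congr rfl fun j _ => ?_
    rw [← mul_assoc, Finset.mul_sum]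
    refine Finset.sum_congr rfl fun l _ => ?_
    have hexp : Real.exp (-(((j : ℝ) + 1) * r * x)) =
        Real.exp (-(r * x)) * Real.exp (-(j * (r * x))) := by
      rw [← Real.exp_add]; congr 1; ring
    rw [hexp, mul_pow, pow_add]
    ring
  have hint : ∀ j l : ℕ, IntegrableOn (fun x : ℝ =>
      C * ((-1 : ℝ) ^ j * ((N - 1).choose j : ℝ)) * expandCoeff t j l * r ^ l *
          (x ^ (t + l) * Real.exp (-(((j : ℝ) + 1) * r * x)))) (Set.Ioi 0) := fun j l =>
    (integrableOn_pow_mul_exp_neg_mul_Ioi (t + l) (by positivity)).const_mul _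
  constructor
  · rw [integrableOn_congr_fun hexpand measurableSet_Ioi]
    exact integrable_finsetSum _ fun j _ => integrable_finsetSum _ fun l _ => hint j l
  · rw [setIntegral_congr_fun measurableSet_Ioi hexpand, integral_finsetSum _
      fun j _ => integrable_finsetSum _ fun l _ => hint j l, erlangMaxMean, Finset.mul_sum]
    refine Finset.sum_congr rfl fun j _ => ?_
    rw [integral_finsetSum (Finset.range ((t - 1) * j + 1)) (fun l _ => hint j l),
      Finset.mul_sum, Finset.mul_sum]
    refine Finset.sum_congr rfl fun l _ => ?_
    rw [integral_const_mul, integral_pow_mul_exp_neg_mul_Ioi _ (by positivity), hC, mul_pow]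
    have h1 : ((t - 1).factorial : ℝ) ≠ 0 := by positivity
    have h2 : (j : ℝ) + 1 ≠ 0 := by positivity
    rw [show r ^ (t + l + 1) = r ^ t * r ^ l * r by ring]
    field_simp

lemma integrable_iSup_and_integral_eq_erlangMaxMean {N t : ℕ} (hN : 0 < N) (ht : 0 < t) {r : ℝ}
    (hr : 0 < r) :
    Integrable (fun y : Fin N → ℝ => ⨆ i, y i) (Measure.pi fun _ : Fin N => erlang t r) ∧
      ∫ y : Fin N → ℝ, (⨆ i, y i) ∂(Measure.pi fun _ : Fin N => erlang t r) =
        erlangMaxMean N t r := by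
  obtain ⟨hint, hval⟩ := integrableOn_and_integral_mul_erlangMaxPDFReal hN ht hr
  have hmeas : Measurable fun x => ENNReal.ofReal (erlangMaxPDFReal N t r x) :=
    (measurable_erlangMaxPDFReal N t r).ennreal_ofReal
  have htop : ∀ᵐ x, ENNReal.ofReal (erlangMaxPDFReal N t r x) < ⊤ := by simp
  have hfun : (fun x => (ENNReal.ofReal (erlangMaxPDFReal N t r x)).toReal • id x) =
      fun x => x * erlangMaxPDFReal N t r x := by
    funext x
    rw [ENNReal.toReal_ofReal (erlangMaxPDFReal_nonneg N ht hr x), smul_eq_mul, mul_comm, id]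
  have hsupp : ∀ x ∉ Set.Ioi (0 : ℝ), x * erlangMaxPDFReal N t r x = 0 := by
    intro x hx
    rcases (le_of_not_gt hx : x ≤ 0).lt_or_eq with h | h
    · rw [erlangMaxPDFReal, if_neg (not_le.2 h), mul_zero]
    · rw [h, zero_mul]
  have hmap := map_iSup_pi_erlang hN ht hr
  constructor
  · change Integrable (id ∘ fun y : Fin N → ℝ => ⨆ i, y i) _
    rw [← integrable_map_measure aestronglyMeasurable_id measurable_iSup_apply.aemeasurable, hmap,
      integrable_withDensity_iff_integrable_smul' hmeas htop, hfun]
    exact (integrableOn_iff_integrable_of_support_subset fun x hx => by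
      by_contra h; exact hx (hsupp x h)).1 hint
  · change ∫ y : Fin N → ℝ, id (⨆ i, y i) ∂_ = _
    rw [← integral_map measurable_iSup_apply.aemeasurable aestronglyMeasurable_id, hmap,
      integral_withDensity_eq_integral_toReal_smul hmeas htop, hfun,
      ← setIntegral_eq_integral_of_forall_compl_eq_zero hsupp, hval]

/-! ### From task times to the law of the waiting time -/

/-- Nonempty index sets make the real suprema true maxima; over an empty one the supremum would
default to `0`. -/
lemma waitingTime_le_iff {Ω : Type*} {c : ℕ} {n τ : Fin c → ℕ}
    {X : (u : Fin c) → Fin (n u) → Fin (τ u) → Ω → ℝ} (hn : ∀ u, 0 < n u) (hc : 0 < c) (ω : Ω) (x : ℝ) :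
    waitingTime X ω ≤ x ↔ ∀ p : (u : Fin c) × Fin (n u), workerTime X p.1 p.2 ω ≤ x := by
  have : Nonempty (Fin c) := ⟨⟨0, hc⟩⟩
  have : ∀ u, Nonempty (Fin (n u)) := fun u => ⟨⟨0, hn u⟩⟩
  rw [waitingTime, ciSup_le_iff (Set.finite_range _).bddAbove]
  simp only [clusterTime, ciSup_le_iff (Set.finite_range _).bddAbove, Sigma.forall]

section

variable {Ω : Type*} [MeasurableSpace Ω] {P : Measure Ω}

/-- Disjoint groups of independent random variables are independent. -/
lemma iIndepFun_curry {ι : Type*} {κ : ι → Type*} {E : Type*} [MeasurableSpace E]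
    {Z : (i : ι) → κ i → Ω → E} (hZ : ∀ i j, Measurable (Z i j))
    (h : iIndepFun (fun p : (i : ι) × κ i => Z p.1 p.2) P) :
    iIndepFun (fun i ω j => Z i j ω) P := by
  have := h.isProbabilityMeasure
  have : ∀ i j, IsProbabilityMeasure (P.map (Z i j)) :=
    fun i j => Measure.isProbabilityMeasure_map (hZ i j).aemeasurable
  have hcurry : (MeasurableEquiv.piCurry fun (i : ι) (_ : κ i) => E) ∘
      (fun ω (p : (i : ι) × κ i) => Z p.1 p.2 ω) = fun ω i j => Z i j ω := by
    ext; simp [Sigma.curry]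
  have hjoint : P.map (fun ω (p : (i : ι) × κ i) => Z p.1 p.2 ω) =
      Measure.infinitePi fun p => P.map (Z p.1 p.2) :=
    h.map_fun_eq_infinitePi_map fun p => hZ p.1 p.2
  -- Independence means that the joint law is a product; currying turns the product over pairs into
  -- a product of products.
  rw [iIndepFun_iff_map_fun_eq_infinitePi_map (by fun_prop), ← hcurry,
    ← Measure.map_map (by fun_prop) (by fun_prop), hjoint,
    Measure.infinitePi_map_piCurry (fun i j => P.map (Z i j))]
  congr 1
  funext i
  exact ((h.precomp (g := fun j => (⟨i, j⟩ : (i : ι) × κ i))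
    (fun a b hab => by simpa using hab)).map_fun_eq_infinitePi_map fun j => hZ i j).symm

lemma map_sum_of_expMeasure {ι : Type*} {r : ℝ} (hr : 0 < r) {Y : ι → Ω → ℝ}
    (hY : ∀ i, Measurable (Y i)) (hlaw : ∀ i, P.map (Y i) = expMeasure r)
    (hind : iIndepFun Y P) {S : Finset ι} (hS : S.Nonempty) :
    P.map (∑ i ∈ S, Y i) = erlang S.card r := by
  have := hind.isProbabilityMeasure
  induction hS using Finset.Nonempty.cons_induction with
  | singleton a => simp [hlaw, erlang, expMeasure]
  | cons a S ha hS ih =>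
    rw [Finset.sum_cons, Finset.card_cons, add_comm,
      (hind.indepFun_finsetSum_of_notMem hY ha).map_add_eq_map_conv_map
        (by fun_prop) (hY a), ih, hlaw, erlang_conv_expMeasure (Finset.card_pos.2 hS) hr]

variable {k m : ℕ} {c : ℕ} {n τ : Fin c → ℕ} {lam s : Fin c → ℝ}
  {X : (u : Fin c) → Fin (n u) → Fin (τ u) → Ω → ℝ}

lemma IsAdditiveServiceTime.measurable_workerTime
    (hX : IsAdditiveServiceTime P k m n τ lam s X) (u : Fin c) (i : Fin (n u)) :
    Measurable (workerTime X u i) :=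
  Finset.measurable_sum _ fun j _ => hX.measurable u i j

lemma IsAdditiveServiceTime.map_workerTime (hX : IsAdditiveServiceTime P k m n τ lam s X)
    (hk : 0 < k) (hm : 0 < m) {u : Fin c} (hτ : 0 < τ u) (hlam : 0 < lam u) (i : Fin (n u)) :
    P.map (workerTime X u i) =
      shiftedErlang (τ u) (τ u * s u / (k * m)) (lam u * (k * m)) := by
  have hr : 0 < lam u * ((k : ℝ) * m) := by positivity
  set a : ℝ := s u / (k * m) with ha
  have hXm := hX.measurable u i
  have hYm : ∀ j, Measurable fun ω => X u i j ω - a := fun j =>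
    (hX.measurable u i j).sub_const a
  have hYlaw : ∀ j, P.map (fun ω => X u i j ω - a) = expMeasure (lam u * (k * m)) := by
    intro j
    change P.map ((fun x => x - a) ∘ X u i j) = _
    rw [← Measure.map_map (by fun_prop) (hX.measurable u i j), hX.law, shiftedExp,
      Measure.map_map (by fun_prop) (by fun_prop)]
    convert Measure.map_id
    funext x
    simp [ha]
  have hind : iIndepFun (fun j ω => X u i j ω - a) P :=
    (hX.indep.precomp (g := fun j => (⟨u, (i, j)⟩ : (u : Fin c) × (Fin (n u) × Fin (τ u))))
      (fun j j' h => by simpa using h)).comp (fun _ x => x - a) (fun _ => by fun_prop)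
  have hne : (Finset.univ : Finset (Fin (τ u))).Nonempty := ⟨⟨0, hτ⟩, Finset.mem_univ _⟩
  have hsum := map_sum_of_expMeasure hr hYm hYlaw hind hne
  rw [Finset.card_univ, Fintype.card_fin] at hsum
  rw [shiftedErlang, ← hsum, Measure.map_map (by fun_prop) (by fun_prop)]
  congr 1
  funext ω
  simp [workerTime, ha, Finset.sum_apply]
  ring

lemma IsAdditiveServiceTime.iIndepFun_workerTime
    (hX : IsAdditiveServiceTime P k m n τ lam s X) :
    iIndepFun (fun p : (u : Fin c) × Fin (n u) => workerTime X p.1 p.2) P := by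
  -- Reindexing the tasks as (worker, task) pairs exposes the grouping by worker.
  have hinj : Function.Injective (fun q : (p : (u : Fin c) × Fin (n u)) × Fin (τ p.1) =>
      (⟨q.1.1, (q.1.2, q.2)⟩ : (u : Fin c) × (Fin (n u) × Fin (τ u)))) := by
    rintro ⟨⟨u, i⟩, j⟩ ⟨⟨u', i'⟩, j'⟩ h
    obtain ⟨rfl, h⟩ := Sigma.mk.inj_iff.1 h
    simp only [heq_eq_eq, Prod.mk.injEq] at h
    obtain ⟨rfl, rfl⟩ := h
    rfl
  have hgroup := iIndepFun_curry (Z := fun (p : (u : Fin c) × Fin (n u)) (j : Fin (τ p.1)) =>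
    X p.1 p.2 j) (fun p j => hX.measurable _ _ _) (hX.indep.precomp hinj)
  exact hgroup.comp (fun p (y : Fin (τ p.1) → ℝ) => ∑ j, y j) (fun p => by fun_prop)

lemma IsAdditiveServiceTime.measurable_waitingTime
    (hX : IsAdditiveServiceTime P k m n τ lam s X) : Measurable (waitingTime X) :=
  Measurable.iSup fun u => Measurable.iSup fun i => hX.measurable_workerTime u i

lemma IsAdditiveServiceTime.measureReal_waitingTime_le
    (hX : IsAdditiveServiceTime P k m n τ lam s X)
    (hk : 0 < k) (hm : 0 < m) (hn : ∀ u, 0 < n u) (hc : 0 < c) (hτ : ∀ u, 0 < τ u)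
    (hlam : ∀ u, 0 < lam u) (x : ℝ) :
    P.real {ω | waitingTime X ω ≤ x} = ∏ p : (u : Fin c) × Fin (n u),
      (shiftedErlang (τ p.1) (τ p.1 * s p.1 / (k * m)) (lam p.1 * (k * m))).real (Set.Iic x) := by
  have hset : {ω | waitingTime X ω ≤ x} =
      ⋂ p ∈ (Finset.univ : Finset ((u : Fin c) × Fin (n u))),
        workerTime X p.1 p.2 ⁻¹' Set.Iic x := by
    ext ω
    simp only [Set.mem_ofPred_eq, waitingTime_le_iff hn hc, Set.mem_iInter, Finset.mem_univ,
      true_implies, Set.mem_preimage, Set.mem_Iic]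
  rw [measureReal_def, hset, hX.iIndepFun_workerTime.measure_inter_preimage_eq_mul _
    (fun _ _ => measurableSet_Iic), ENNReal.toReal_prod]
  refine Finset.prod_congr rfl fun p _ => ?_
  rw [measureReal_def, ← hX.map_workerTime hk hm (hτ p.1) (hlam p.1) p.2,
    Measure.map_apply (hX.measurable_workerTime _ _) measurableSet_Iic]

end

/-! ### Comparison of distribution functions and of means -/

lemma shiftedErlang_real_Iic {t : ℕ} (ht : 0 < t) {r : ℝ} (hr : 0 < r) {a x : ℝ} (hx : a ≤ x) :
    (shiftedErlang t a r).real (Set.Iic x) = erlangBase t (r * (x - a)) := by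
  rw [measureReal_def, shiftedErlang_Iic, erlang_Iic ht hr (sub_nonneg.2 hx),
    ENNReal.toReal_ofReal (erlangBase_nonneg ht (mul_nonneg hr.le (sub_nonneg.2 hx)))]

lemma shiftedErlang_real_Iic_of_lt (t : ℕ) (r : ℝ) {a x : ℝ} (hx : x < a) :
    (shiftedErlang t a r).real (Set.Iic x) = 0 := by
  rw [measureReal_def, shiftedErlang_Iic, erlang_Iic_of_neg _ _ (sub_neg.2 hx),
    ENNReal.toReal_zero]

lemma one_sub_sum_eq_erlangBase {t : ℕ} {l K x a : ℝ} (hK : K ≠ 0) :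
    1 - ∑ j ∈ Finset.range t,
      Real.exp (l * a - l * K * x) / (j.factorial : ℝ) * (l * K * x - l * a) ^ j =
      erlangBase t (l * K * (x - a / K)) := by
  have h : l * K * (x - a / K) = l * K * x - l * a := by field_simp
  rw [erlangBase, h, neg_sub]

/-- Stochastic domination by the faster and smaller Erlang law with the smaller shift. -/
lemma erlangBase_le_erlangBase {t t' : ℕ} (ht : 0 < t) (htt : t ≤ t') {l l' K x a a' : ℝ}
    (hK : 0 < K) (hl : 0 < l') (hll : l' ≤ l) (haa : a ≤ a') (hx : a' ≤ x) :
    erlangBase t' (l' * K * (x - a')) ≤ erlangBase t (l * K * (x - a)) := by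
  have h0 : 0 ≤ l' * K * (x - a') := mul_nonneg (by positivity) (sub_nonneg.2 hx)
  have hle : l' * K * (x - a') ≤ l * K * (x - a) := by
    have := sub_nonneg.2 hx
    have : 0 ≤ l := hl.le.trans hll
    gcongr
  exact (antitone_erlangBase h0 htt).trans
    ((strictMonoOn_erlangBase ht).monotoneOn h0 (h0.trans hle) hle)

/-- Since `x > a'`, a larger rate strictly increases the argument, while a smaller shape gives a
strict gain at a positive argument. -/
lemma erlangBase_lt_erlangBase {t t' : ℕ} (ht : 0 < t) (htt : t ≤ t') {l l' K x a a' : ℝ}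
    (hK : 0 < K) (hl : 0 < l') (hll : l' ≤ l) (haa : a ≤ a') (hx : a' < x)
    (hne : l ≠ l' ∨ t ≠ t') :
    erlangBase t' (l' * K * (x - a')) < erlangBase t (l * K * (x - a)) := by
  have hxa := sub_pos.2 hx
  have h0 : 0 < l' * K * (x - a') := by positivity
  rcases hne with hne | hne
  · have hlt : l' < l := lt_of_le_of_ne hll (Ne.symm hne)
    have hle : l' * K * (x - a') < l * K * (x - a) :=
      mul_lt_mul (by gcongr) (by linarith) hxa (by have := hl.trans hlt; positivity)
    exact (antitone_erlangBase h0.le htt).trans_lt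
      (strictMonoOn_erlangBase ht h0.le (h0.le.trans hle.le) hle)
  · exact (strictAnti_erlangBase h0 (lt_of_le_of_ne htt hne)).trans_le
      (erlangBase_le_erlangBase ht le_rfl hK hl hll haa hx.le)

/-- If `f` exceeds `a` almost surely and the tail of `f - a` is dominated by that of an integrable
nonnegative `g`, then `f` is integrable with mean at most `a` plus the mean of `g`. -/
lemma integrable_and_integral_le_of_tail_le {Ω Ω' : Type*} [MeasurableSpace Ω]
    [MeasurableSpace Ω'] {P : Measure Ω} [IsProbabilityMeasure P] {Q : Measure Ω'}
    [IsFiniteMeasure Q] {f : Ω → ℝ} {g : Ω' → ℝ} {a : ℝ} (hf : Measurable f)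
    (hfa : ∀ᵐ ω ∂P, a ≤ f ω) (hg : Integrable g Q) (hg0 : 0 ≤ᵐ[Q] g)
    (htail : ∀ t, 0 < t → P.real {ω | t + a < f ω} ≤ Q.real {ω | t < g ω}) :
    Integrable f P ∧ ∫ ω, f ω ∂P ≤ a + ∫ ω, g ω ∂Q := by
  have hnn : 0 ≤ᵐ[P] fun ω => f ω - a := by
    filter_upwards [hfa] with ω h using sub_nonneg.2 h
  have hm : Measurable fun ω => f ω - a := hf.sub_const a
  -- Layer-cake formula on both sides: the means compare because the tails do.
  have hlin : ∫⁻ ω, ENNReal.ofReal (f ω - a) ∂P ≤ ∫⁻ ω, ENNReal.ofReal (g ω) ∂Q := by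
    rw [lintegral_eq_lintegral_meas_lt P hnn hm.aemeasurable,
      lintegral_eq_lintegral_meas_lt Q hg0 hg.aemeasurable]
    refine setLIntegral_mono' measurableSet_Ioi fun t ht => ?_
    have h := htail t ht
    rw [measureReal_def, measureReal_def, ENNReal.toReal_le_toReal (measure_ne_top _ _)
      (measure_ne_top _ _)] at h
    simpa only [lt_sub_iff_add_lt] using h
  rw [← ofReal_integral_eq_lintegral_ofReal hg hg0] at hlin
  have hint : Integrable (fun ω => f ω - a) P :=
    (lintegral_ofReal_ne_top_iff_integrable hm.aestronglyMeasurable hnn).1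
      (hlin.trans_lt ENNReal.ofReal_lt_top).ne
  rw [← ofReal_integral_eq_lintegral_ofReal hint hnn,
    ENNReal.ofReal_le_ofReal_iff (integral_nonneg_of_ae hg0)] at hlin
  have hfint : Integrable f P :=
    (hint.add (integrable_const a)).congr (ae_of_all _ fun ω => by simp)
  refine ⟨hfint, ?_⟩
  rw [integral_sub hfint (integrable_const a)] at hlin
  simp at hlin
  linarith

/-! ### The main theorem -/

theorem theorem3 {Ω : Type*} [MeasurableSpace Ω] (P : Measure Ω) [IsProbabilityMeasure P]
    (k m : ℕ) (hk : 0 < k) (hm : 0 < m)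
    {c : ℕ} (n τ : Fin c → ℕ) (hn : ∀ u, 0 < n u) (hτ : ∀ u, 0 < τ u)
    (lam s : Fin c → ℝ) (hlam : ∀ u, 0 < lam u)
    (tm : ℝ) (htm : ∀ u, lam u * s u = tm)
    (slow : Fin c) (hslow : ∀ u, lam slow ≤ lam u)
    (X : (u : Fin c) → Fin (n u) → Fin (τ u) → Ω → ℝ)
    (hX : IsAdditiveServiceTime P k m n τ lam s X)
    (N τmax : ℕ) (hN : N = ∑ u, n u) (hτmax : IsGreatest (Set.range τ) τmax)
    (sm : ℝ) (hsm : IsGreatest (Set.range fun u => s u * (τ u : ℝ)) sm) :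
    -- every worker's time is a shifted Erlang variable
    (∀ u i, P.map (workerTime X u i) =
      shiftedErlang (τ u) (τ u * s u / (k * m)) (lam u * (k * m))) ∧
    -- the tail bound
    (∀ x : ℝ, sm / (k * m) ≤ x →
      P.real {ω | x < waitingTime X ω} ≤
        1 - (1 - ∑ j ∈ Finset.range τmax,
          Real.exp (lam slow * sm - lam slow * (k * m) * x) / (j.factorial : ℝ) *
            (lam slow * (k * m) * x - lam slow * sm) ^ j) ^ N) ∧
    -- the tail bound is strict beyond the shift unless all clusters behave alike
    ((∃ u, lam u ≠ lam slow ∨ τ u ≠ τmax) → ∀ x : ℝ, sm / (k * m) < x →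
      P.real {ω | x < waitingTime X ω} <
        1 - (1 - ∑ j ∈ Finset.range τmax,
          Real.exp (lam slow * sm - lam slow * (k * m) * x) / (j.factorial : ℝ) *
            (lam slow * (k * m) * x - lam slow * sm) ^ j) ^ N) ∧
    -- the distribution function vanishes below the shift
    (∀ x : ℝ, x < sm / (k * m) → P.real {ω | waitingTime X ω ≤ x} = 0) ∧
    -- the base of the power is the distribution function of a shifted Erlang law
    (∀ x : ℝ, sm / (k * m) ≤ x →
      cdf (shiftedErlang τmax (sm / (k * m)) (lam slow * (k * m))) x =
        1 - ∑ j ∈ Finset.range τmax,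
          Real.exp (lam slow * sm - lam slow * (k * m) * x) / (j.factorial : ℝ) *
            (lam slow * (k * m) * x - lam slow * sm) ^ j) ∧
    -- the bound on the mean
    (Integrable (waitingTime X) P ∧
      ∫ ω, waitingTime X ω ∂P ≤ sm / (k * m) + erlangMaxMean N τmax (lam slow * (k * m))) ∧
    -- `Φ` is the mean of the maximum of `N` independent Erlang variables
    (Integrable (fun y : Fin N → ℝ => ⨆ i, y i)
        (Measure.pi fun _ : Fin N => erlang τmax (lam slow * (k * m))) ∧
      ∫ y : Fin N → ℝ, (⨆ i, y i)
          ∂(Measure.pi fun _ : Fin N => erlang τmax (lam slow * (k * m))) =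
        erlangMaxMean N τmax (lam slow * (k * m))) := by
  obtain ⟨⟨u₁, hu₁⟩, hτle⟩ := hτmax
  obtain ⟨⟨u₂, hu₂⟩, hsle⟩ := hsm
  have hτle' : ∀ u, τ u ≤ τmax := fun u => hτle ⟨u, rfl⟩
  have hsle' : ∀ u, s u * (τ u : ℝ) ≤ sm := fun u => hsle ⟨u, rfl⟩
  have ht : 0 < τmax := hu₁ ▸ hτ u₁
  have hc : 0 < c := slow.pos
  have hNpos : 0 < N := by
    rw [hN]
    exact Finset.sum_pos (fun u _ => hn u) ⟨slow, Finset.mem_univ _⟩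
  have hK : 0 < (k : ℝ) * m := by positivity
  have hmap : ∀ u i, P.map (workerTime X u i) =
      shiftedErlang (τ u) (τ u * s u / (k * m)) (lam u * (k * m)) := fun u i =>
    hX.map_workerTime hk hm (hτ u) (hlam u) i
  have hprod := hX.measureReal_waitingTime_le hk hm hn hc hτ hlam
  set K : ℝ := (k : ℝ) * m with hKdef
  have hr : ∀ u, 0 < lam u * K := fun u => mul_pos (hlam u) hK
  have hshift : ∀ u, τ u * s u / K ≤ sm / K := fun u => by
    rw [mul_comm]
    exact div_le_div_of_nonneg_right (hsle' u) hK.le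
  have hcard : Fintype.card ((u : Fin c) × Fin (n u)) = N := by
    rw [Fintype.card_sigma, hN]; simp
  -- The `N`-th power is written as a product over workers, to be compared factor by factor.
  have hpow : ∀ y : ℝ, y ^ N = ∏ _p : (u : Fin c) × Fin (n u), y := fun y => by
    rw [Finset.prod_const, Finset.card_univ, hcard]
  have hcdf : ∀ x, sm / K ≤ x → P.real {ω | waitingTime X ω ≤ x} =
      ∏ p : (u : Fin c) × Fin (n u),
        erlangBase (τ p.1) (lam p.1 * K * (x - τ p.1 * s p.1 / K)) := fun x hx => by
    rw [hprod]
    exact Finset.prod_congr rfl fun p _ =>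
      shiftedErlang_real_Iic (hτ _) (hr _) ((hshift _).trans hx)
  have hmeas := hX.measurable_waitingTime
  have htail : ∀ x, P.real {ω | x < waitingTime X ω} =
      1 - P.real {ω | waitingTime X ω ≤ x} := fun x => by
    rw [← probReal_compl_eq_one_sub (measurableSet_le hmeas measurable_const)]
    congr 1
    ext ω
    simp
  have hbase : ∀ x, sm / K ≤ x →
      0 ≤ erlangBase τmax (lam slow * K * (x - sm / K)) := fun x hx =>
    erlangBase_nonneg ht (mul_nonneg (hr slow).le (sub_nonneg.2 hx))
  have hbound : ∀ x, sm / K ≤ x → P.real {ω | x < waitingTime X ω} ≤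
      1 - erlangBase τmax (lam slow * K * (x - sm / K)) ^ N := fun x hx => by
    rw [htail, hcdf x hx, hpow]
    refine sub_le_sub_left (Finset.prod_le_prod (fun _ _ => hbase x hx) fun p _ => ?_) _
    exact erlangBase_le_erlangBase (hτ _) (hτle' _) hK (hlam slow) (hslow _) (hshift _) hx
  have hzero : ∀ x, x < sm / K → P.real {ω | waitingTime X ω ≤ x} = 0 := fun x hx => by
    rw [hprod]
    -- A worker of the cluster attaining `sm` needs at least `sm / K`, so its factor vanishes.
    refine Finset.prod_eq_zero (Finset.mem_univ ⟨u₂, ⟨0, hn u₂⟩⟩) ?_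
    refine shiftedErlang_real_Iic_of_lt _ _ ?_
    rw [mul_comm]
    simpa only [hu₂] using hx
  obtain ⟨hmaxint, hmaxmean⟩ :=
    integrable_iSup_and_integral_eq_erlangMaxMean hNpos ht (hr slow)
  have := isProbabilityMeasure_erlang ht (hr slow)
  have : Nonempty (Fin N) := ⟨⟨0, hNpos⟩⟩
  have hmaxcdf : ∀ t, 0 ≤ t → (Measure.pi fun _ : Fin N => erlang τmax (lam slow * K)).real
      {y | ⨆ i, y i ≤ t} = erlangBase τmax (lam slow * K * t) ^ N := fun t h0 => by
    rw [measureReal_def, pi_setOf_iSup_le, ENNReal.toReal_prod, Finset.prod_const,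
      Finset.card_univ, Fintype.card_fin, erlang_Iic ht (hr slow) h0,
      ENNReal.toReal_ofReal (erlangBase_nonneg ht (mul_nonneg (hr slow).le h0))]
  refine ⟨hmap, fun x hx => ?_, fun hne x hx => ?_, hzero, fun x hx => ?_, ?_,
    hmaxint, hmaxmean⟩
  · rw [one_sub_sum_eq_erlangBase hK.ne']
    exact hbound x hx
  · rw [one_sub_sum_eq_erlangBase hK.ne', htail, hcdf x hx.le, hpow]
    obtain ⟨u, hu⟩ := hne
    -- One strict factor suffices because the smaller factors are all positive, which uses `x > sm /
    -- K`.
    refine sub_lt_sub_left (Finset.prod_lt_prod (fun _ _ => ?_) (fun p _ => ?_)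
      ⟨⟨u, ⟨0, hn u⟩⟩, Finset.mem_univ _, ?_⟩) _
    · exact erlangBase_pos ht (mul_pos (hr slow) (sub_pos.2 hx))
    · exact erlangBase_le_erlangBase (hτ _) (hτle' _) hK (hlam slow) (hslow _) (hshift _) hx.le
    · exact erlangBase_lt_erlangBase (hτ _) (hτle' _) hK (hlam slow) (hslow _) (hshift _) hx hu
  · have := isProbabilityMeasure_shiftedErlang ht (sm / K) (hr slow)
    rw [one_sub_sum_eq_erlangBase hK.ne', cdf_eq_real, shiftedErlang_real_Iic ht (hr slow) hx]
  · rw [← hmaxmean]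
    refine integrable_and_integral_le_of_tail_le hmeas ?_ hmaxint ?_ fun t h0 => ?_
    · have hseq : ∀ j : ℕ, ∀ᵐ ω ∂P, sm / K - 1 / ((j : ℝ) + 1) < waitingTime X ω := fun j => by
        have hlt : sm / K - 1 / ((j : ℝ) + 1) < sm / K := sub_lt_self _ (by positivity)
        have h := (measureReal_eq_zero_iff (measure_ne_top _ _)).1 (hzero _ hlt)
        simpa only [ae_iff, not_lt] using h
      filter_upwards [ae_all_iff.2 hseq] with ω hω
      refine le_of_forall_pos_lt_add fun ε hε => ?_
      obtain ⟨j, hj⟩ := exists_nat_one_div_lt hε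
      linarith [hω j]
    -- The maximum is almost surely positive, since its distribution function vanishes at `0`.
    · have h := (measureReal_eq_zero_iff (measure_ne_top _ _)).1
        ((hmaxcdf 0 le_rfl).trans (by simp [erlangBase_zero ht, hNpos.ne']))
      rw [Filter.EventuallyLE, ae_iff]
      refine measure_mono_null (fun y hy => ?_) h
      exact (not_le.1 hy).le
    · refine (hbound (t + sm / K) (by linarith)).trans_eq ?_
      rw [add_sub_cancel_right, ← hmaxcdf t h0.le,
        ← probReal_compl_eq_one_sub (measurableSet_le measurable_iSup_apply measurable_const)]
      congr 1
      ext y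
      simp
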